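/- Let $j,k\ge 0$ and $n$ be integers with $0<j+k<n$. For $0\le m<n$ let $G_{n,m}$ be the Grassmannian of $m$-dimensional linear subspaces of $\mathbb R^n$ and $G(n,m)$ the set of all $m$-dimensional affine planes in $\mathbb R^n$; every $\zeta\in G(n,m)$ is written uniquely as $\zeta=\eta+v$ with $\eta\in G_{n,m}$, $v\in\eta^\perp$. For a subspace $X\subset\mathbb R^n$, $G_m(X)$ denotes the Grassmannian of $m$-dimensional linear subspaces of $X$. Define - the $m$-plane transform of $f:\mathbb R^n\to\mathbb C$: $(R_mf)(\eta+v)=\int_\eta f(v+y)\,dy$, with Euclidean measure on $\eta$; - the dual transform of $\varphi:G(n,m)\to\mathbb C$: $(R_m^*\varphi)(x)=\int_{O(n)}\varphi(\gamma\eta_0+x)\,d\gamma$, where $d\gamma$ is the Haar probability measure and $\eta_0\in G_{n,m}$ is an arbitrary fixed subspace; - the mixed transform of $f:G(n,j)\to\mathbb C$, integrating over the $j$-planes that meet $\zeta=\eta+v\in G(n,k)$ at a right angle: $(R_{j,k}f)(\eta+v)=\int_{G_j(\eta^\perp)}d\xi\int_\eta f(\xi+u+v)\,du$, where $d\xi$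 is the rotation-invariant probability measure on $G_j(\eta^\perp)$; $R_{k,j}$ is defined likewise with $j$ and $k$ interchanged; - the Riesz potential: $(I_n^{\alpha}h)(x)=\frac1{\gamma_n(\alpha)}\int_{\mathbb R^n}\frac{h(y)\,dy}{|x-y|^{n-\alpha}}$, $\ \gamma_n(\alpha)=\frac{2^\alpha\pi^{n/2}\Gamma(\alpha/2)}{\Gamma((n-\alpha)/2)}$. **Theorem (Fuglede-type formula).** Let $h:\mathbb R^n\to\mathbb C$ and $x\in\mathbb R^n$ be such that $(I_n^{j+k}h)(x)$ exists in the Lebesgue sense, that is, $y\mapsto h(y)|x-y|^{j+k-n}$ is Lebesgue integrable on $\mathbb R^n$. Then $(R_k^*R_{j,k}R_jh)(x)$ and $(R_j^*R_{k,j}R_kh)(x)$ exist in the Lebesgue sense, and $$(R_k^*R_{j,k}R_jh)(x)=(R_j^*R_{k,j}R_kh)(x)=c\,(I_n^{j+k}h)(x),\qquad c=\frac{2^{j+k}\pi^{(j+k)/2}\,\Gamma(n/2)}{\Gamma((n-j-k)/2)}.$$ Here existence of $(R_k^*R_{j,k}R_jh)(x)$ means that the integral defining $R_k^*$ at $x$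 is absolutely convergent; for almost every $\gamma\in O(n)$ the integral defining $R_{j,k}$ at $\zeta=\gamma\eta_0+x$ is absolutely convergent with respect to the measure $d\xi\,du$; and, for almost all such $\gamma$, the integral defining $R_jh$ is absolutely convergent at almost every $j$-plane that meets $\zeta$ at a right angle. The existence of $(R_j^*R_{k,j}R_kh)(x)$ is understood in the same way. (For $j=0$, where $R_0$ and $R_{0,k}$ reduce to $h\mapsto h$ and $R_k$, the formula becomes Fuglede's formula $R_k^*R_kh=c\,I_n^kh$, and similarly for $k=0$.) -/

import Mathlib

open MeasureTheory

noncomputable section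

namespace MixedRadon

/-! ### The orthogonal group and the Grassmannian of a Euclidean space -/

section Grassmannian

variable (W : Type*) [NormedAddCommGroup W] [InnerProductSpace ℝ W] [FiniteDimensional ℝ W]
  [CompleteSpace W]

/-- The orthogonal group `O(W)`: the operators `γ` on `W` with `γ* γ = γ γ* = 1`, with the
topology and the Borel structure inherited from the operator norm. -/
abbrev OrthGroup : Type _ := ↥(unitary (W →L[ℝ] W))

instance : CompactSpace (OrthGroup W) := by
  have : ProperSpace (W →L[ℝ] W) := FiniteDimensional.proper ℝ _
  have hc : IsClosed (unitary (W →L[ℝ] W) : Set (W →L[ℝ] W)) := by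
    have h1 : (unitary (W →L[ℝ] W) : Set (W →L[ℝ] W)) =
        {u | star u * u = 1} ∩ {u | u * star u = 1} := by
      ext u
      simp [Unitary.mem_iff]
    rw [h1]
    exact (isClosed_eq (by fun_prop) continuous_const).inter
      (isClosed_eq (by fun_prop) continuous_const)
  have hb : Bornology.IsBounded (unitary (W →L[ℝ] W) : Set (W →L[ℝ] W)) := by
    refine (Metric.isBounded_closedBall (x := 0) (r := 1)).subset fun u hu => ?_
    rw [mem_closedBall_zero_iff]
    exact ContinuousLinearMap.opNorm_le_bound _ zero_le_one fun x => by
      rw [ContinuousLinearMap.norm_map_of_mem_unitary hu, one_mul]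
  exact isCompact_iff_compactSpace.mp (Metric.isCompact_of_isClosed_isBounded hc hb)

/-- The invariant (Haar) probability measure on the compact group `O(W)`. -/
def haarO : Measure (OrthGroup W) := Measure.haarMeasure ⊤

instance : IsProbabilityMeasure (haarO W) :=
  ⟨by simpa [haarO] using Measure.haarMeasure_self (G := OrthGroup W) (K₀ := ⊤)⟩

/-- The Grassmannian `G_j(W)` of `j`-dimensional linear subspaces of `W`. -/
structure Gr (j : ℕ) where
  space : Submodule ℝ W
  finrank_eq : Module.finrank ℝ space = j

/-- The Borel structure of `G_j(W)`, a subspace being identified with the orthogonal projection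
onto it. -/
instance instMeasurableSpaceGr (j : ℕ) : MeasurableSpace (Gr W j) :=
  MeasurableSpace.comap (fun ξ => ξ.space.starProjection) (borel (W →L[ℝ] W))

variable {W}

/-- The rotated subspace `γ ξ`. -/
def Gr.rotate {j : ℕ} (γ : OrthGroup W) (ξ : Gr W j) : Gr W j :=
  ⟨ξ.space.map ((γ : W →L[ℝ] W) : W →ₗ[ℝ] W), by
    have hi : Function.Injective ((γ : W →L[ℝ] W) : W →ₗ[ℝ] W) := by
      refine (injective_iff_map_eq_zero _).2 fun x hx => ?_
      rw [← norm_eq_zero, ← Unitary.norm_map γ x]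
      simpa using hx
    exact (Submodule.equivMapOfInjective _ hi ξ.space).finrank_eq.symm.trans ξ.finrank_eq⟩

/-- The map `γ ↦ γ ξ` is measurable, since the projection onto `γ ξ` is `γ P γ*`, where `P` is the
projection onto `ξ`. -/
theorem Gr.measurable_rotate {j : ℕ} (ξ : Gr W j) : Measurable (fun γ => Gr.rotate γ ξ) := by
  rw [measurable_iff_comap_le, instMeasurableSpaceGr, MeasurableSpace.comap_comp,
    ← measurable_iff_comap_le]
  have h1 : ((fun ξ : Gr W j => ξ.space.starProjection) ∘ fun γ => Gr.rotate γ ξ) =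
      fun γ : OrthGroup W =>
        (γ : W →L[ℝ] W) * ξ.space.starProjection * star (γ : W →L[ℝ] W) := by
    funext γ
    ext w
    simp only [Function.comp]
    refine Submodule.eq_starProjection_of_mem_of_inner_eq_zero ?_ ?_
    · exact ⟨_, Submodule.starProjection_apply_mem ξ.space _, rfl⟩
    · rintro _ ⟨z, hz, rfl⟩
      have e : w = (γ : W →L[ℝ] W) (star (γ : W →L[ℝ] W) w) := by
        rw [← mul_apply_eq_comp, Unitary.mul_star_self_of_mem γ.2]; rfl
      nth_rewrite 1 [e]
      simp only [mul_apply_eq_comp, ContinuousLinearMap.coe_coe]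
      rw [← map_sub, Unitary.inner_map_map]
      exact Submodule.starProjection_inner_eq_zero _ _ hz
  rw [h1]
  have hc : Continuous fun γ : OrthGroup W =>
      (γ : W →L[ℝ] W) * ξ.space.starProjection * star (γ : W →L[ℝ] W) := by fun_prop
  exact hc.measurable

variable (W)

open Classical in
/-- The canonical (`O(W)`-invariant) probability measure on `G_j(W)`: the law of `γ ξ₀`, where `ξ₀`
is a fixed `j`-dimensional subspace and `γ` is distributed according to the Haar probability
measure of `O(W)`. (If `W` has no `j`-dimensional subspaces, then `G_j(W)` is empty.) -/
def grMeasure (j : ℕ) : Measure (Gr W j) :=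
  if hne : Nonempty (Gr W j) then (haarO W).map (fun γ => Gr.rotate γ hne.some) else 0

theorem isProbabilityMeasure_grMeasure (j : ℕ) [hne : Nonempty (Gr W j)] :
    IsProbabilityMeasure (grMeasure W j) := by
  rw [grMeasure, dif_pos hne]
  exact Measure.isProbabilityMeasure_map (Gr.measurable_rotate _).aemeasurable

end Grassmannian

/-! ### Affine planes -/

/-- The Euclidean space `ℝⁿ`. -/
abbrev E (n : ℕ) : Type := EuclideanSpace ℝ (Fin n)

/-- The affine Grassmannian `G(n, k)` of `k`-dimensional affine planes in `ℝⁿ`. -/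
structure AffGr (n k : ℕ) where
  space : AffineSubspace ℝ (E n)
  nonempty : (space : Set (E n)).Nonempty
  finrank_eq : Module.finrank ℝ space.direction = k

variable {n : ℕ}

/-- The affine plane `ξ + a`. -/
def plane {j : ℕ} (ξ : Gr (E n) j) (a : E n) : AffGr n j :=
  ⟨AffineSubspace.mk' a ξ.space, AffineSubspace.mk'_nonempty a ξ.space, by
    rw [AffineSubspace.direction_mk', ξ.finrank_eq]⟩

/-- The linear direction `η` of a plane `ζ = η + v`. -/
abbrev AffGr.dir {k : ℕ} (ζ : AffGr n k) : Submodule ℝ (E n) := ζ.space.direction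

/-- The vector `v ∈ ηᗮ` of a plane `ζ = η + v`, i.e. the point of `ζ` nearest to the origin. -/
def AffGr.foot {k : ℕ} (ζ : AffGr n k) : E n :=
  have : Nonempty ζ.space := ζ.nonempty.to_subtype
  (EuclideanGeometry.orthogonalProjection ζ.space (0 : E n) : E n)

/-- A subspace of `X ⊆ ℝⁿ` as a subspace of `ℝⁿ`. -/
def Gr.incl {X : Submodule ℝ (E n)} {j : ℕ} (ξ : Gr X j) : Gr (E n) j :=
  ⟨ξ.space.map X.subtype, 
    (Submodule.equivMapOfInjective _ X.subtype_injective ξ.space).finrank_eq.symm.trans ξ.finrank_eq⟩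

/-! ### The Radon transforms

Each operator comes with a predicate saying that the integral defining it at a given point exists
in the Lebesgue sense. -/

/-- The `k`-plane transform `(R_k f)(ζ) = ∫_η f(v + y) d_η y`, `ζ = η + v`. -/
def planeTransform (k : ℕ) (f : E n → ℂ) (ζ : AffGr n k) : ℂ :=
  ∫ y : ζ.dir, f (ζ.foot + y)

/-- The integral `(R_k f)(ζ)` exists. -/
def PlaneTransformExists (k : ℕ) (f : E n → ℂ) (ζ : AffGr n k) : Prop :=
  Integrable (fun y : ζ.dir => f (ζ.foot + y))

/-- The dual `k`-plane transform `(R_k^* φ)(x) = ∫_{O(n)} φ(γ η₀ + x) dγ`, where `η₀` is a fixed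
`k`-plane through the origin. -/
def dualTransform {k : ℕ} (η₀ : Gr (E n) k) (φ : AffGr n k → ℂ) (x : E n) : ℂ :=
  ∫ γ, φ (plane (Gr.rotate γ η₀) x) ∂(haarO (E n))

/-- The integral `(R_k^* φ)(x)` exists. -/
def DualTransformExists {k : ℕ} (η₀ : Gr (E n) k) (φ : AffGr n k → ℂ) (x : E n) : Prop :=
  Integrable (fun γ => φ (plane (Gr.rotate γ η₀) x)) (haarO (E n))

/-- The mixed `j`-plane to `k`-plane Radon transform
`(R_{j,k} f)(ζ) = ∫_{G_j(ηᗮ)} dξ ∫_η f(ξ + u + v) d_η u`, `ζ = η + v`: the integral of `f` over the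
`j`-planes that meet `ζ` at a right angle. -/
def mixedTransform (j k : ℕ) (f : AffGr n j → ℂ) (ζ : AffGr n k) : ℂ :=
  ∫ ξ : Gr ζ.dirᗮ j, (∫ u : ζ.dir, f (plane ξ.incl (u + ζ.foot))) ∂(grMeasure ζ.dirᗮ j)

/-- The measure `dξ d_η u` on `G_j(ηᗮ) × η`, which parametrizes the `j`-planes that meet
`ζ = η + v` at a right angle. -/
def incidenceMeasure (j : ℕ) {k : ℕ} (ζ : AffGr n k) : Measure (Gr ζ.dirᗮ j × ζ.dir) :=
  (grMeasure ζ.dirᗮ j).prod volume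

/-- The integral `(R_{j,k} f)(ζ)` exists. -/
def MixedTransformExists (j k : ℕ) (f : AffGr n j → ℂ) (ζ : AffGr n k) : Prop :=
  Integrable (fun p : Gr ζ.dirᗮ j × ζ.dir => f (plane p.1.incl (p.2 + ζ.foot)))
    (incidenceMeasure j ζ)

/-- The composition `(R_k^* R_{j,k} R_j h)(x)`. -/
def Lam (j : ℕ) {k : ℕ} (η₀ : Gr (E n) k) (h : E n → ℂ) (x : E n) : ℂ :=
  dualTransform η₀ (mixedTransform j k (planeTransform j h)) x

/-- The composition `(R_k^* R_{j,k} R_j h)(x)` exists: the integral `R_k^*` at `x` exists, the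
integral `R_{j,k}` exists at almost every `k`-plane `ζ` through `x`, and for almost all these `ζ`
the integral `R_j h` exists at almost every `j`-plane that meets `ζ` at a right angle. -/
def LamExists (j : ℕ) {k : ℕ} (η₀ : Gr (E n) k) (h : E n → ℂ) (x : E n) : Prop :=
  DualTransformExists η₀ (mixedTransform j k (planeTransform j h)) x ∧
  ∀ᵐ γ ∂(haarO (E n)),
    MixedTransformExists j k (planeTransform j h) (plane (Gr.rotate γ η₀) x) ∧
    ∀ᵐ p ∂(incidenceMeasure j (plane (Gr.rotate γ η₀) x)),
      PlaneTransformExists j h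
        (plane p.1.incl (p.2 + (plane (Gr.rotate γ η₀) x).foot))

/-! ### The Riesz potential -/

/-- The normalizing constant
`γ_n(α) = 2^α π^{n/2} Γ(α/2) / Γ((n-α)/2)` of the Riesz potential. -/
def rieszConst (n : ℕ) (α : ℝ) : ℝ :=
  2 ^ α * Real.pi ^ ((n : ℝ) / 2) * Real.Gamma (α / 2) / Real.Gamma (((n : ℝ) - α) / 2)

/-- The Riesz potential `(I_n^α f)(x) = γ_n(α)⁻¹ ∫ f(y) |x - y|^{α - n} dy`. -/
def rieszPotential (α : ℝ) (f : E n → ℂ) (x : E n) : ℂ :=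
  (rieszConst n α)⁻¹ • ∫ y : E n, (‖x - y‖ ^ ((n : ℝ) - α))⁻¹ • f y

/-- The integral `(I_n^α f)(x)` exists. -/
def RieszPotentialExists (α : ℝ) (f : E n → ℂ) (x : E n) : Prop :=
  Integrable (fun y : E n => (‖x - y‖ ^ ((n : ℝ) - α))⁻¹ • f y)

end MixedRadon

end

/-!
The proof reduces the composition `R_k^* R_{j,k} R_j h` at `x` to one absolutely convergent integral.
Fix `η₀` of dimension `k` and put `m = j + k`. The `k`-planes through `x` are `γ η₀ + x`, and the
`j`-planes which meet `γ η₀ + x` at a right angle are `γ ξ + γ u + x`, where `u ∈ η₀` and `ξ` is a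
`j`-dimensional subspace of `η₀ᗮ` (`exists_incidence_parametrization`; the invariant measure on the
Grassmannian is transported by isometries, `Gr.measurePreserving_mapEquiv`). Hence the composition
is the integral of `h (x + γ (u + y))` over `γ ∈ O(n)`, `ξ`, `u ∈ η₀` and `y ∈ ξ`.

The domain of `y` depends on `ξ`. To have a product space, and with it joint measurability in
`ξ` and `u`, one writes `∫_ξ f(y) dy` as the integral of `exp (-π |z - P z|²) f(P z)` over
`z ∈ η₀ᗮ`, where `P` is the projection onto `ξ` (`integral_gaussWeight`). The integrand is then a
function on a product of σ-finite spaces that do not depend on one another.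

The law of `γ (u + y)` under the product measure is computed in `map_point_paramMeasure`: averaging
over `γ` replaces a test function by a radial one, a radial function has the same integral over
each of the `m`-dimensional spaces `η₀ ⊕ ξ`, and polar coordinates in `ℝᵐ` and in `ℝⁿ` show that the
law is `|S^{m-1}| / |S^{n-1}|` times `|v|^{m-n} dv`. So, by the hypothesis on the Riesz potential,
the integral over all parameters converges absolutely. Fubini's theorem then gives all the
existence statements and the value (`lamExists_and_lam_eq`). The value is symmetric in `j` and `k`,
and its constant is the one in the theorem (`sphereArea_div_eq`).
-/

noncomputable section

namespace MixedRadon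

/-! ### Invariance of the measures on the orthogonal group and on the Grassmannian -/

section Invariance

set_option linter.unusedSectionVars false

variable {W W' : Type*} [NormedAddCommGroup W] [InnerProductSpace ℝ W] [FiniteDimensional ℝ W]
  [CompleteSpace W] [NormedAddCommGroup W'] [InnerProductSpace ℝ W'] [FiniteDimensional ℝ W']
  [CompleteSpace W']

instance isHaarMeasure_haarO : (haarO W).IsHaarMeasure := by
  unfold haarO; infer_instance

instance isMulRightInvariant_haarO : (haarO W).IsMulRightInvariant where
  map_mul_right_eq_self g := by
    have hm : Measurable fun γ : OrthGroup W => γ * g := (continuous_mul_const g).measurable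
    have : IsProbabilityMeasure ((haarO W).map (· * g)) :=
      Measure.isProbabilityMeasure_map hm.aemeasurable
    exact Measure.isHaarMeasure_eq_of_isProbabilityMeasure _ _

/-- Conjugation `γ ↦ e γ e⁻¹` by a linear isometry `e`, as an isomorphism `O(W) ≃ O(W')`. -/
def conjOrth (e : W ≃ₗᵢ[ℝ] W') : OrthGroup W ≃* OrthGroup W' :=
  (Unitary.mapEquiv { MulEquivClass.toMulEquiv e.conjStarAlgEquiv with
    map_star' := map_star e.conjStarAlgEquiv }).toMulEquiv

theorem conjOrth_apply (e : W ≃ₗᵢ[ℝ] W') (γ : OrthGroup W) (x : W') :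
    (conjOrth e γ : W' →L[ℝ] W') x = e ((γ : W →L[ℝ] W) (e.symm x)) := rfl

theorem continuous_conjOrth (e : W ≃ₗᵢ[ℝ] W') : Continuous (conjOrth e) := by
  refine Continuous.subtype_mk (f := fun γ : OrthGroup W =>
    (e : W →L[ℝ] W') ∘L (γ : W →L[ℝ] W) ∘L (e.symm : W' →L[ℝ] W)) ?_ _
  fun_prop

theorem measurePreserving_conjOrth (e : W ≃ₗᵢ[ℝ] W') :
    MeasurePreserving (conjOrth e) (haarO W) (haarO W') :=
  MonoidHom.measurePreserving (f := (conjOrth e).toMonoidHom) (continuous_conjOrth e)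
    (conjOrth e).surjective (by simp)

namespace Gr

@[ext] theorem ext {j : ℕ} {ξ ξ' : Gr W j} (h : ξ.space = ξ'.space) : ξ = ξ' := by
  cases ξ; cases ξ'; congr

/-- The image of a subspace under a linear isometry. -/
def map {j : ℕ} (e : W ≃ₗᵢ[ℝ] W') (ξ : Gr W j) : Gr W' j :=
  ⟨ξ.space.map (e.toLinearEquiv : W →ₗ[ℝ] W'),
    (e.submoduleMap ξ.space).toLinearEquiv.finrank_eq.symm.trans ξ.finrank_eq⟩

theorem measurable_starProjection (j : ℕ) :
    Measurable fun ξ : Gr W j => ξ.space.starProjection := by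
  rw [BorelSpace.measurable_eq (α := W →L[ℝ] W)]
  exact comap_measurable _

theorem measurable_map {j : ℕ} (e : W ≃ₗᵢ[ℝ] W') : Measurable (map e : Gr W j → Gr W' j) := by
  rw [measurable_iff_comap_le, instMeasurableSpaceGr, MeasurableSpace.comap_comp,
    ← measurable_iff_comap_le]
  have h1 : (fun ξ : Gr W' j => ξ.space.starProjection) ∘ (map e) =
      fun ξ : Gr W j => (e : W →L[ℝ] W') ∘L ξ.space.starProjection ∘L (e.symm : W' →L[ℝ] W) := by
    funext ξ
    ext x
    exact Submodule.starProjection_map_apply e ξ.space x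
  rw [h1]
  have hc : Continuous fun P : W →L[ℝ] W =>
    (e : W →L[ℝ] W') ∘L P ∘L (e.symm : W' →L[ℝ] W) := by fun_prop
  have := hc.measurable.comp (measurable_starProjection (W := W) j)
  rwa [BorelSpace.measurable_eq (α := W' →L[ℝ] W')] at this

theorem map_symm_map {j : ℕ} (e : W ≃ₗᵢ[ℝ] W') (ξ : Gr W j) : map e.symm (map e ξ) = ξ := by
  ext x
  simp [map]

/-- The bijection `G_j(W) ≃ G_j(W')` induced by a linear isometry. -/
def mapEquiv (j : ℕ) (e : W ≃ₗᵢ[ℝ] W') : Gr W j ≃ᵐ Gr W' j where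
  toFun := map e
  invFun := map e.symm
  left_inv := map_symm_map e
  right_inv := map_symm_map e.symm
  measurable_toFun := measurable_map e
  measurable_invFun := measurable_map e.symm

theorem map_rotate {j : ℕ} (e : W ≃ₗᵢ[ℝ] W') (γ : OrthGroup W) (ξ : Gr W j) :
    map e (rotate γ ξ) = rotate (conjOrth e γ) (map e ξ) := by
  ext x
  constructor
  · rintro ⟨_, ⟨y, hy, rfl⟩, rfl⟩
    exact ⟨e y, ⟨y, hy, rfl⟩, by simp [conjOrth_apply]⟩
  · rintro ⟨_, ⟨y, hy, rfl⟩, rfl⟩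
    exact ⟨(γ : W →L[ℝ] W) y, ⟨y, hy, rfl⟩, by simp [conjOrth_apply]⟩

theorem rotate_mul {j : ℕ} (γ δ : OrthGroup W) (ξ : Gr W j) :
    rotate (γ * δ) ξ = rotate γ (rotate δ ξ) := by
  ext x
  simp [rotate, Submodule.mem_map]

/-- `O(W)` acts transitively on `G_j(W)`. -/
theorem exists_rotate_eq {j : ℕ} (ξ ξ' : Gr W j) : ∃ γ : OrthGroup W, rotate γ ξ = ξ' := by
  let i : ξ.space ≃ₗᵢ[ℝ] ξ'.space := (stdOrthonormalBasis ℝ ξ.space).equiv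
    (stdOrthonormalBasis ℝ ξ'.space) (finCongr (ξ.finrank_eq.trans ξ'.finrank_eq.symm))
  let L : W ≃ₗᵢ[ℝ] W := LinearIsometry.toLinearIsometryEquiv
    (ξ'.space.subtypeₗᵢ.comp i.toLinearIsometry).extend rfl
  have hL (s : ξ.space) : L s = i s := LinearIsometry.extend_apply _ s
  refine ⟨Unitary.linearIsometryEquiv.symm L, ?_⟩
  ext x
  simp only [rotate, Submodule.mem_map]
  constructor
  · rintro ⟨y, hy, rfl⟩
    have : L y ∈ ξ'.space := by rw [hL ⟨y, hy⟩]; exact (i _).2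
    exact this
  · intro hx
    refine ⟨i.symm ⟨x, hx⟩, (i.symm _).2, ?_⟩
    have : L (i.symm ⟨x, hx⟩) = x := by rw [hL]; simp
    exact this

/-- The invariant measure on `G_j(W)` does not depend on the choice of the base point. -/
theorem grMeasure_eq_map_rotate {j : ℕ} (ξ : Gr W j) :
    grMeasure W j = (haarO W).map fun γ => rotate γ ξ := by
  have hne : Nonempty (Gr W j) := ⟨ξ⟩
  obtain ⟨δ, hδ⟩ := exists_rotate_eq ξ hne.some
  rw [grMeasure, dif_pos hne, ← hδ]
  nth_rewrite 2 [← map_mul_right_eq_self (haarO W) δ]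
  rw [Measure.map_map (measurable_rotate _) (continuous_mul_const δ).measurable]
  simp only [Function.comp_def, rotate_mul]

theorem measurePreserving_mapEquiv {j : ℕ} (e : W ≃ₗᵢ[ℝ] W') (hne : Nonempty (Gr W j)) :
    MeasurePreserving (mapEquiv j e) (grMeasure W j) (grMeasure W' j) := by
  refine ⟨(mapEquiv j e).measurable, ?_⟩
  obtain ⟨ξ⟩ := hne
  rw [grMeasure_eq_map_rotate ξ, grMeasure_eq_map_rotate (map e ξ),
    Measure.map_map (mapEquiv j e).measurable (measurable_rotate _),
    ← (measurePreserving_conjOrth e).map_eq,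
    Measure.map_map (measurable_rotate _) (measurePreserving_conjOrth e).measurable]
  congr 1
  funext γ
  exact map_rotate e γ ξ

end Gr

/-- The average over `O(W)` of a function depends only on the norm of the argument. -/
theorem lintegral_haarO_apply_eq (g : W → ENNReal) {v w : W} (h : ‖v‖ = ‖w‖) :
    ∫⁻ γ, g ((γ : W →L[ℝ] W) v) ∂haarO W = ∫⁻ γ, g ((γ : W →L[ℝ] W) w) ∂haarO W := by
  -- a reflection takes `w` to `v`
  let δ : OrthGroup W :=
    Unitary.linearIsometryEquiv.symm (Submodule.reflection (Submodule.span ℝ {w - v})ᗮ)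
  have hδ : (δ : W →L[ℝ] W) w = v := Submodule.reflection_sub h.symm
  rw [← lintegral_mul_right_eq_self (fun γ : OrthGroup W => g ((γ : W →L[ℝ] W) w)) δ]
  simp [← hδ]

end Invariance

/-! ### Integration over a subspace as a Gaussian integral over the whole space -/

section Gaussian

variable {V : Type*} [NormedAddCommGroup V] [InnerProductSpace ℝ V] [FiniteDimensional ℝ V]

/-- The Gaussian weight `exp (-π |z - P z|²)`, where `P` is the orthogonal projection onto `S`. Its
integral over each fibre of `P` is `1`. -/
def gaussWeight (S : Submodule ℝ V) (z : V) : ℝ :=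
  Real.exp (-Real.pi * ‖z - S.starProjection z‖ ^ 2)

theorem gaussWeight_nonneg (S : Submodule ℝ V) (z : V) : 0 ≤ gaussWeight S z :=
  (Real.exp_pos _).le

variable [MeasurableSpace V] [BorelSpace V]

theorem integral_gaussian : ∫ v : V, Real.exp (-Real.pi * ‖v‖ ^ 2) = 1 := by
  rw [GaussianFourier.integral_rexp_neg_mul_sq_norm Real.pi_pos, div_self Real.pi_ne_zero,
    Real.one_rpow]

theorem lintegral_gaussian : ∫⁻ v : V, ENNReal.ofReal (Real.exp (-Real.pi * ‖v‖ ^ 2)) = 1 := by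
  rw [← ofReal_integral_eq_lintegral_ofReal, integral_gaussian, ENNReal.ofReal_one]
  · exact Integrable.of_integral_ne_zero (by rw [integral_gaussian]; exact one_ne_zero)
  · exact Filter.Eventually.of_forall fun v => (Real.exp_pos _).le

/-- The decomposition `V ≃ Sᗮ × S`. -/
def orthogonalSplit (S : Submodule ℝ V) : V ≃ᵐ Sᗮ × S :=
  (S.orthogonalDecomposition.toMeasurableEquiv.trans
    (MeasurableEquiv.toLp 2 _).symm).trans MeasurableEquiv.prodComm

theorem measurePreserving_orthogonalSplit (S : Submodule ℝ V) :
    MeasurePreserving (orthogonalSplit S) volume (volume.prod volume) :=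
  (S.orthogonalDecomposition.measurePreserving.trans
    (WithLp.volume_preserving_ofLp _ _)).trans Measure.measurePreserving_swap

theorem orthogonalSplit_snd (S : Submodule ℝ V) (z : V) :
    (orthogonalSplit S z).2 = S.orthogonalProjectionOnto z := by
  simp [orthogonalSplit, MeasurableEquiv.prodComm]

theorem gaussWeight_eq (S : Submodule ℝ V) (z : V) :
    gaussWeight S z = Real.exp (-Real.pi * ‖(orthogonalSplit S z).1‖ ^ 2) := by
  have : (orthogonalSplit S z).1 = Sᗮ.orthogonalProjectionOnto z := by
    simp [orthogonalSplit, MeasurableEquiv.prodComm]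
  rw [this, gaussWeight, ← Submodule.norm_coe, ← Submodule.starProjection_apply,
    Submodule.starProjection_orthogonal_val]

theorem lintegral_gaussWeight (S : Submodule ℝ V) {g : V → ENNReal} (hg : Measurable g) :
    ∫⁻ z, ENNReal.ofReal (gaussWeight S z) * g (S.starProjection z) = ∫⁻ y : S, g y := by
  have h1 := (measurePreserving_orthogonalSplit S).lintegral_comp_emb
    (orthogonalSplit S).measurableEmbedding
    (fun p => ENNReal.ofReal (Real.exp (-Real.pi * ‖p.1‖ ^ 2)) * g p.2)
  simp only [← gaussWeight_eq, orthogonalSplit_snd] at h1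
  simp only [Submodule.starProjection_apply]
  rw [h1, lintegral_prod_mul (f := fun t : Sᗮ => ENNReal.ofReal (Real.exp (-Real.pi * ‖t‖ ^ 2)))
    (g := fun y : S => g y) (by fun_prop) (by fun_prop), lintegral_gaussian, one_mul]

variable {F : Type*} [NormedAddCommGroup F] [NormedSpace ℝ F]

theorem integral_gaussWeight (S : Submodule ℝ V) (f : V → F) :
    ∫ z, gaussWeight S z • f (S.starProjection z) = ∫ y : S, f y := by
  have h1 := (measurePreserving_orthogonalSplit S).integral_comp
    (orthogonalSplit S).measurableEmbedding
    (fun p => Real.exp (-Real.pi * ‖p.1‖ ^ 2) • f p.2)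
  simp only [← gaussWeight_eq, orthogonalSplit_snd] at h1
  simp only [Submodule.starProjection_apply]
  rw [h1, integral_prod_smul (fun t : Sᗮ => Real.exp (-Real.pi * ‖t‖ ^ 2)) (fun y : S => f y),
    integral_gaussian, one_smul]

theorem integrable_of_gaussWeight (S : Submodule ℝ V) {f : V → F}
    (h : Integrable fun z => gaussWeight S z • f (S.starProjection z)) :
    Integrable fun y : S => f y := by
  have h1 := (measurePreserving_orthogonalSplit S).integrable_comp_emb
    (orthogonalSplit S).measurableEmbedding
    (g := fun p => Real.exp (-Real.pi * ‖p.1‖ ^ 2) • f p.2)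
  simp only [Function.comp_def, ← gaussWeight_eq, orthogonalSplit_snd] at h1
  simp only [Submodule.starProjection_apply] at h
  -- almost every section of an integrable function on `Sᗮ × S` is integrable; one section suffices
  obtain ⟨t, ht⟩ := (h1.1 h).prod_right_ae.exists
  exact (integrable_smul_iff (Real.exp_pos (-Real.pi * ‖t‖ ^ 2)).ne' _).1 ht

end Gaussian

/-! ### Radial functions -/

/-- The area `2 π^{d/2} / Γ(d/2)` of the unit sphere in `ℝᵈ`. -/
def sphereArea (d : ℕ) : ℝ := 2 * Real.pi ^ ((d : ℝ) / 2) / Real.Gamma ((d : ℝ) / 2)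

theorem sphereArea_pos {d : ℕ} (hd : 0 < d) : 0 < sphereArea d := by
  have := Real.Gamma_pos_of_pos (s := (d : ℝ) / 2) (by positivity)
  unfold sphereArea
  positivity

theorem toSphere_univ {V : Type*} [NormedAddCommGroup V] [InnerProductSpace ℝ V]
    [FiniteDimensional ℝ V] [MeasurableSpace V] [BorelSpace V] [Nontrivial V] :
    (volume : Measure V).toSphere Set.univ =
      ENNReal.ofReal (sphereArea (Module.finrank ℝ V)) := by
  have hd : 0 < Module.finrank ℝ V := Module.finrank_pos
  have hG := Real.Gamma_pos_of_pos (s := (Module.finrank ℝ V : ℝ) / 2) (by positivity)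
  rw [Measure.toSphere_apply_univ, InnerProductSpace.volume_ball, ENNReal.ofReal_one, one_pow,
    one_mul, ← ENNReal.ofReal_natCast, ← ENNReal.ofReal_mul (by positivity)]
  congr 1
  rw [Real.Gamma_add_one (by positivity), sphereArea, Real.sqrt_eq_rpow, ← Real.rpow_mul_natCast
    Real.pi_pos.le, one_div_mul_eq_div]
  field_simp

theorem lintegral_comp_norm {V : Type*} [NormedAddCommGroup V] [InnerProductSpace ℝ V]
    [FiniteDimensional ℝ V] [MeasurableSpace V] [BorelSpace V] (hd : 0 < Module.finrank ℝ V)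
    {G : ℝ → ENNReal} (hG : Measurable G) :
    ∫⁻ v : V, G ‖v‖ = ENNReal.ofReal (sphereArea (Module.finrank ℝ V)) *
      ∫⁻ r in Set.Ioi (0 : ℝ), ENNReal.ofReal (r ^ (Module.finrank ℝ V - 1)) * G r := by
  have : Nontrivial V := Module.nontrivial_of_finrank_pos hd
  calc
    ∫⁻ v : V, G ‖v‖ = ∫⁻ v : ({0}ᶜ : Set V), G ‖v.1‖ ∂(volume.comap Subtype.val) := by
      rw [lintegral_subtype_comap (measurableSet_singleton _).compl fun v => G ‖v‖,
        restrict_compl_singleton]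
    _ = ∫⁻ p, G p.2 ∂(volume : Measure V).toSphere.prod
          (Measure.volumeIoiPow (Module.finrank ℝ V - 1)) := by
      simpa using (volume : Measure V).measurePreserving_homeomorphUnitSphereProd.lintegral_comp_emb
        (Homeomorph.measurableEmbedding _) (fun p => G p.2)
    _ = (volume : Measure V).toSphere Set.univ *
          ∫⁻ r : Set.Ioi (0 : ℝ), G r ∂Measure.volumeIoiPow (Module.finrank ℝ V - 1) := by
      have := lintegral_prod_mul (μ := (volume : Measure V).toSphere)
        (ν := Measure.volumeIoiPow (Module.finrank ℝ V - 1)) (f := fun _ => 1)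
        (g := fun r => G r) (by fun_prop) (by fun_prop)
      simpa using this
    _ = _ := by
      rw [toSphere_univ, Measure.volumeIoiPow, lintegral_withDensity_eq_lintegral_mul _
        (by fun_prop) (by fun_prop)]
      congr 1
      exact lintegral_subtype_comap measurableSet_Ioi
        fun r : ℝ => ENNReal.ofReal (r ^ (Module.finrank ℝ V - 1)) * G r

/-- The integral of a radial function over the orthogonal direct sum of two spaces. -/
theorem lintegral_lintegral_norm_add {V : Type*} [NormedAddCommGroup V] [InnerProductSpace ℝ V]
    [FiniteDimensional ℝ V] [MeasurableSpace V] [BorelSpace V] {S T : Submodule ℝ V}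
    (hST : S ⟂ T) (hd : 0 < Module.finrank ℝ S + Module.finrank ℝ T)
    {G : ℝ → ENNReal} (hG : Measurable G) :
    ∫⁻ u : S, ∫⁻ y : T, G ‖(u : V) + y‖ =
      ENNReal.ofReal (sphereArea (Module.finrank ℝ S + Module.finrank ℝ T)) *
      ∫⁻ r in Set.Ioi (0 : ℝ),
        ENNReal.ofReal (r ^ (Module.finrank ℝ S + Module.finrank ℝ T - 1)) * G r := by
  have hn (p : WithLp 2 (S × T)) : ‖(p.ofLp.1 : V) + p.ofLp.2‖ = ‖p‖ := by
    rw [← sq_eq_sq₀ (norm_nonneg _) (norm_nonneg _), WithLp.prod_norm_sq_eq_of_L2, sq,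
      norm_add_sq_eq_norm_sq_add_norm_sq_of_inner_eq_zero _ _
        (hST.inner_eq p.ofLp.1.2 p.ofLp.2.2), ← sq, ← sq]
    rfl
  have hf : Module.finrank ℝ (WithLp 2 (S × T)) = Module.finrank ℝ S + Module.finrank ℝ T := by
    rw [(WithLp.linearEquiv 2 ℝ (S × T)).finrank_eq, Module.finrank_prod]
  have h1 := lintegral_comp_norm (V := WithLp 2 (S × T)) (by rwa [hf]) hG
  rw [hf] at h1
  rw [← h1, ← lintegral_prod (f := fun p : S × T => G ‖(p.1 : V) + p.2‖) (by fun_prop),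
    ← Measure.volume_eq_prod, ← (WithLp.volume_preserving_ofLp S T).lintegral_comp (by fun_prop)]
  simp only [hn]

/-! ### The law of a random point of a random `j + k`-dimensional subspace -/

section Law

/-- A linear isometry, restricted to a subspace and to its image. -/
def restrictIsometry {V V' : Type*} [NormedAddCommGroup V] [InnerProductSpace ℝ V]
    [NormedAddCommGroup V'] [InnerProductSpace ℝ V'] (L : V →ₗᵢ[ℝ] V') {S : Submodule ℝ V}
    {T : Submodule ℝ V'} (h : S.map L.toLinearMap = T) : S ≃ₗᵢ[ℝ] T where
  toLinearEquiv := (Submodule.equivMapOfInjective L.toLinearMap L.injective S).trans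
    (LinearEquiv.ofEq _ _ h)
  norm_map' s := L.norm_map s

instance isFiniteMeasure_grMeasure {W : Type*} [NormedAddCommGroup W] [InnerProductSpace ℝ W]
    [FiniteDimensional ℝ W] [CompleteSpace W] (j : ℕ) : IsFiniteMeasure (grMeasure W j) := by
  by_cases hne : Nonempty (Gr W j)
  · have := isProbabilityMeasure_grMeasure W j
    infer_instance
  · rw [grMeasure, dif_neg hne]
    infer_instance

theorem Gr.nonempty {W : Type*} [NormedAddCommGroup W] [InnerProductSpace ℝ W]
    [FiniteDimensional ℝ W] {j : ℕ} (hj : j ≤ Module.finrank ℝ W) : Nonempty (Gr W j) := by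
  obtain ⟨f, hf⟩ := exists_linearIndependent_of_le_finrank (R := ℝ) (M := W) hj
  exact ⟨⟨Submodule.span ℝ (Set.range f), by simpa using finrank_span_eq_card hf⟩⟩

variable {n : ℕ} (j : ℕ) (X : Submodule ℝ (E n))

/-- The space of parameters `(γ, (ξ, u), z)`, with `γ ∈ O(n)`, `ξ ∈ G_j(Xᗮ)`, `u ∈ X`, `z ∈ Xᗮ`. -/
abbrev Param : Type := OrthGroup (E n) × ((Gr Xᗮ j × X) × Xᗮ)

/-- The product of the invariant probability measures on `O(n)` and on `G_j(Xᗮ)` and of the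
Lebesgue measures on `X` and on `Xᗮ`. -/
def paramMeasure : Measure (Param j X) :=
  (haarO (E n)).prod (((grMeasure Xᗮ j).prod volume).prod volume)

variable {j X}

/-- The point `γ (u + P z)`, where `P` is the projection onto `ξ`. It lies in `γ (X ⊕ ξ)`. -/
def Param.point (p : Param j X) : E n :=
  (p.1 : E n →L[ℝ] E n) (p.2.1.2 + p.2.1.1.space.starProjection p.2.2 : E n)

/-- The weight which turns the integration over `z ∈ Xᗮ` into an integration over `ξ`. -/
def Param.weight (p : Param j X) : ℝ := gaussWeight p.2.1.1.space p.2.2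

theorem measurable_starProjection_apply :
    Measurable fun q : (Gr Xᗮ j × X) × Xᗮ => q.1.1.space.starProjection q.2 := by
  have h1 : Measurable fun q : (Gr Xᗮ j × X) × Xᗮ => (q.1.1.space.starProjection, q.2) :=
    ((Gr.measurable_starProjection j).comp (by fun_prop)).prodMk (by fun_prop)
  have h2 : Continuous fun q : (Xᗮ →L[ℝ] Xᗮ) × Xᗮ => q.1 q.2 := by fun_prop
  exact h2.measurable.comp h1

theorem measurable_add_starProjection : Measurable fun q : (Gr Xᗮ j × X) × Xᗮ =>
    (q.1.2 + q.1.1.space.starProjection q.2 : E n) := by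
  have := measurable_starProjection_apply (j := j) (X := X)
  exact Measurable.add (by fun_prop) (measurable_subtype_coe.comp this)

theorem measurable_gaussWeight :
    Measurable fun q : (Gr Xᗮ j × X) × Xᗮ => gaussWeight q.1.1.space q.2 := by
  have h1 : Measurable fun q : (Gr Xᗮ j × X) × Xᗮ => q.2 - q.1.1.space.starProjection q.2 :=
    measurable_snd.sub measurable_starProjection_apply
  exact Real.measurable_exp.comp ((h1.norm.pow_const 2).const_mul _)

theorem Param.measurable_point : Measurable (Param.point : Param j X → E n) := by
  have h1 : Measurable fun p : Param j X =>
      (p.1, (p.2.1.2 + p.2.1.1.space.starProjection p.2.2 : E n)) :=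
    measurable_fst.prodMk (measurable_add_starProjection.comp measurable_snd)
  have h2 : Continuous fun q : OrthGroup (E n) × E n => (q.1 : E n →L[ℝ] E n) q.2 := by fun_prop
  exact h2.measurable.comp h1

theorem Param.measurable_weight : Measurable (Param.weight : Param j X → ℝ) :=
  measurable_gaussWeight.comp measurable_snd

/-- A radial function is integrated over `X ⊕ ξ` as over `ℝᵐ`, whatever `ξ` is; so the average over
`ξ` of the integrals over `X ⊕ ξ` is given by polar coordinates in `ℝᵐ`. -/
theorem lintegral_radial_param (hne : Nonempty (Gr Xᗮ j))
    (hd : 0 < Module.finrank ℝ X + j) {G : ℝ → ENNReal} (hG : Measurable G) :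
    ∫⁻ q : (Gr Xᗮ j × X) × Xᗮ, ENNReal.ofReal (gaussWeight q.1.1.space q.2) *
        G ‖(q.1.2 + q.1.1.space.starProjection q.2 : E n)‖
        ∂((grMeasure Xᗮ j).prod volume).prod volume =
      ENNReal.ofReal (sphereArea (Module.finrank ℝ X + j)) *
      ∫⁻ r in Set.Ioi (0 : ℝ), ENNReal.ofReal (r ^ (Module.finrank ℝ X + j - 1)) * G r := by
  have := isProbabilityMeasure_grMeasure Xᗮ j
  have hmeas : Measurable fun q : (Gr Xᗮ j × X) × Xᗮ =>
      ENNReal.ofReal (gaussWeight q.1.1.space q.2) *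
        G ‖(q.1.2 + q.1.1.space.starProjection q.2 : E n)‖ :=
    measurable_gaussWeight.ennreal_ofReal.mul (hG.comp measurable_add_starProjection.norm)
  have hinner (ξ : Gr Xᗮ j) : ∫⁻ u : X, ∫⁻ z : Xᗮ, ENNReal.ofReal (gaussWeight ξ.space z) *
        G ‖(u + ξ.space.starProjection z : E n)‖ =
      ENNReal.ofReal (sphereArea (Module.finrank ℝ X + j)) *
      ∫⁻ r in Set.Ioi (0 : ℝ), ENNReal.ofReal (r ^ (Module.finrank ℝ X + j - 1)) * G r := by
    have hort : X ⟂ ξ.space.map Xᗮ.subtype :=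
      (Submodule.isOrtho_orthogonal_right X).mono_right (Submodule.map_subtype_le _ _)
    have hdim : Module.finrank ℝ (ξ.space.map Xᗮ.subtype) = j :=
      (Submodule.equivMapOfInjective _ Xᗮ.subtype_injective ξ.space).finrank_eq.symm.trans
        ξ.finrank_eq
    have h1 := lintegral_lintegral_norm_add hort (by rwa [hdim]) hG
    rw [hdim] at h1
    rw [← h1]
    refine lintegral_congr fun u => ?_
    rw [lintegral_gaussWeight ξ.space (g := fun z => G ‖(u + z : E n)‖) (by fun_prop)]
    let e := restrictIsometry Xᗮ.subtypeₗᵢ (S := ξ.space) (T := ξ.space.map Xᗮ.subtype) rfl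
    exact e.measurePreserving.lintegral_comp_emb e.toMeasurableEquiv.measurableEmbedding
      (fun y => G ‖(u + y : E n)‖)
  rw [lintegral_prod _ hmeas.aemeasurable, lintegral_prod _ hmeas.lintegral_prod_right'.aemeasurable]
  simp only [hinner, lintegral_const, measure_univ, mul_one]

/-- If `(ξ, u, y)` runs over `ξ ∈ G_j(Xᗮ)`, `u ∈ X` and `y ∈ ξ`, and `γ` is a random rotation, then
the law of `γ (u + y)` is a multiple of `|v|^{m - n} dv`, where `m = j + dim X`. Both measures are
invariant under rotations, so it suffices to compare them on radial functions. -/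
theorem map_point_paramMeasure (hd : 0 < Module.finrank ℝ X + j)
    (hn : Module.finrank ℝ X + j < n) :
    ((paramMeasure j X).withDensity fun p => (p.weight.toNNReal : ENNReal)).map Param.point =
      ENNReal.ofReal (sphereArea (Module.finrank ℝ X + j) / sphereArea n) •
      (volume : Measure (E n)).withDensity fun v =>
        (((‖v‖ ^ ((n : ℝ) - (Module.finrank ℝ X + j : ℕ)))⁻¹).toNNReal : ENNReal) := by
  set m := Module.finrank ℝ X + j
  have hne : Nonempty (Gr Xᗮ j) := Gr.nonempty (by
    have := Submodule.finrank_add_finrank_orthogonal X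
    rw [finrank_euclideanSpace_fin] at this
    omega)
  have hA : ENNReal.ofReal (sphereArea n) ≠ 0 := by
    simpa using sphereArea_pos (by omega : 0 < n)
  obtain ⟨e, he⟩ : ∃ e : E n, ‖e‖ = 1 := by
    have : Nontrivial (E n) := Module.nontrivial_of_finrank_pos (R := ℝ) (by
      rw [finrank_euclideanSpace_fin]; omega)
    exact exists_norm_eq (E n) zero_le_one
  refine Measure.ext_of_lintegral _ fun g hg => ?_
  have hcont : Continuous fun q : OrthGroup (E n) × E n => (q.1 : E n →L[ℝ] E n) q.2 := by
    fun_prop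
  -- `G r` is the mean value of `g` over the sphere of radius `r`
  set G : ℝ → ENNReal := fun r => ∫⁻ γ, g ((γ : E n →L[ℝ] E n) (r • e)) ∂haarO (E n)
  have hGm : Measurable G := by
    have h1 : Measurable fun q : ℝ × OrthGroup (E n) => g ((q.2 : E n →L[ℝ] E n) (q.1 • e)) :=
      hg.comp (hcont.measurable.comp (g := fun q : OrthGroup (E n) × E n =>
        (q.1 : E n →L[ℝ] E n) q.2)
        (f := fun q : ℝ × OrthGroup (E n) => (q.2, q.1 • e)) (by fun_prop))
    exact h1.lintegral_prod_right'
  have hG (v : E n) : ∫⁻ γ, g ((γ : E n →L[ℝ] E n) v) ∂haarO (E n) = G ‖v‖ :=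
    lintegral_haarO_apply_eq g (by simp [norm_smul, he])
  have hleft : ∫⁻ v, g v ∂((paramMeasure j X).withDensity
      fun p => (p.weight.toNNReal : ENNReal)).map Param.point =
      ENNReal.ofReal (sphereArea m) *
        ∫⁻ r in Set.Ioi (0 : ℝ), ENNReal.ofReal (r ^ (m - 1)) * G r := by
    have hw := Param.measurable_weight (j := j) (X := X)
    have hp := Param.measurable_point (j := j) (X := X)
    rw [lintegral_map hg hp, lintegral_withDensity_eq_lintegral_mul _ (by fun_prop) (by fun_prop),
      paramMeasure, lintegral_prod_symm _ (by
        refine Measurable.aemeasurable (Measurable.mul ?_ ?_) <;> fun_prop),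
      ← lintegral_radial_param hne hd hGm]
    refine lintegral_congr fun q => ?_
    rw [← hG, ← lintegral_const_mul]
    · rfl
    · exact hg.comp (hcont.measurable.comp (by fun_prop : Measurable fun γ : OrthGroup (E n) =>
        (γ, (q.1.2 + q.1.1.space.starProjection q.2 : E n))))
  have hright : ∫⁻ v, g v ∂(volume : Measure (E n)).withDensity (fun v =>
        (((‖v‖ ^ ((n : ℝ) - m))⁻¹).toNNReal : ENNReal)) =
      ENNReal.ofReal (sphereArea n) *
        ∫⁻ r in Set.Ioi (0 : ℝ), ENNReal.ofReal (r ^ (m - 1)) * G r := by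
    set D : ℝ → ENNReal := fun r => ((r ^ ((n : ℝ) - m))⁻¹).toNNReal
    have hDm : Measurable D := by fun_prop
    have hrot (γ : OrthGroup (E n)) : ∫⁻ v : E n, D ‖v‖ * g v =
        ∫⁻ v : E n, D ‖v‖ * g ((γ : E n →L[ℝ] E n) v) := by
      let L := Unitary.linearIsometryEquiv γ
      have := L.measurePreserving.lintegral_comp_emb L.toMeasurableEquiv.measurableEmbedding
        (fun v => D ‖v‖ * g v)
      simp only [LinearIsometryEquiv.norm_map] at this
      exact this.symm
    calc ∫⁻ v, g v ∂(volume : Measure (E n)).withDensity (fun v => D ‖v‖)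
        = ∫⁻ v : E n, D ‖v‖ * g v :=
          lintegral_withDensity_eq_lintegral_mul _ (by fun_prop) hg
      _ = ∫⁻ γ, (∫⁻ v : E n, D ‖v‖ * g ((γ : E n →L[ℝ] E n) v)) ∂haarO (E n) := by
          simp only [← hrot, lintegral_const, measure_univ, mul_one]
      _ = ∫⁻ v : E n, ∫⁻ γ : OrthGroup (E n), D ‖v‖ * g ((γ : E n →L[ℝ] E n) v) ∂haarO (E n) := by
          refine lintegral_lintegral_swap (Measurable.aemeasurable ?_)
          exact Measurable.mul (by fun_prop) (hg.comp hcont.measurable)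
      _ = ∫⁻ v : E n, D ‖v‖ * G ‖v‖ := by
          refine lintegral_congr fun v => ?_
          rw [lintegral_const_mul, hG]
          exact hg.comp (hcont.measurable.comp (by fun_prop :
            Measurable fun γ : OrthGroup (E n) => (γ, v)))
      _ = _ := by
          have hfr : Module.finrank ℝ (E n) = n := finrank_euclideanSpace_fin
          have := lintegral_comp_norm (V := E n) (by omega) (G := fun r => D r * G r)
            (by fun_prop)
          rw [hfr] at this
          rw [this]
          congr 1
          refine setLIntegral_congr_fun measurableSet_Ioi fun r hr => ?_
          have hr0 : (0 : ℝ) < r := hr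
          -- in polar coordinates, the density turns `r ^ (n - 1)` into `r ^ (m - 1)`
          have h2 : r ^ ((n : ℝ) - m) = r ^ (n - m) := by
            rw [← Nat.cast_sub hn.le, Real.rpow_natCast]
          have h3 : r ^ (n - 1) = r ^ (m - 1) * r ^ (n - m) := by
            rw [← pow_add]; congr 1; omega
          have h4 : D r = ENNReal.ofReal ((r ^ (n - m))⁻¹) := by rw [← h2]; rfl
          rw [← mul_assoc, h4, ← ENNReal.ofReal_mul (by positivity), h3,
            mul_inv_cancel_right₀ (by positivity)]
  rw [hleft, lintegral_smul_measure, hright, smul_eq_mul,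
    ENNReal.ofReal_div_of_pos (sphereArea_pos (by omega)), ← mul_assoc,
    ENNReal.div_mul_cancel hA ENNReal.ofReal_ne_top]

end Law

/-! ### The transforms in parametrized form -/

section Transforms

variable {n : ℕ}

theorem AffGr.foot_mem {k : ℕ} (ζ : AffGr n k) : ζ.foot ∈ ζ.space := by
  have : Nonempty ζ.space := ζ.nonempty.to_subtype
  exact (EuclideanGeometry.orthogonalProjection ζ.space (0 : E n)).2

/-- A plane `ζ = foot + dir` is parametrized, with its Lebesgue measure, by any subspace which is
isometric to its direction, with any point `a` of `ζ` as the origin. -/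
theorem AffGr.exists_parametrization {k : ℕ} (ζ : AffGr n k) {V : Type*} [NormedAddCommGroup V]
    [InnerProductSpace ℝ V] [FiniteDimensional ℝ V] [MeasurableSpace V] [BorelSpace V]
    (L : V →ₗᵢ[ℝ] E n) {S : Submodule ℝ V} (hS : S.map L.toLinearMap = ζ.dir) {a : E n}
    (ha : a ∈ ζ.space) :
    ∃ Φ : S ≃ᵐ ζ.dir, MeasurePreserving Φ ∧ ∀ s : S, ζ.foot + Φ s = a + L s := by
  let d : ζ.dir := ⟨a - ζ.foot, ζ.space.vsub_mem_direction ha ζ.foot_mem⟩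
  let e := restrictIsometry L hS
  refine ⟨e.toMeasurableEquiv.trans (MeasurableEquiv.addRight d),
    e.measurePreserving.trans (measurePreserving_add_right volume d), fun s => ?_⟩
  change ζ.foot + (L s + (a - ζ.foot)) = a + L s
  abel

theorem planeTransform_eq {j : ℕ} (f : E n → ℂ) (ζ : AffGr n j) {V : Type*}
    [NormedAddCommGroup V] [InnerProductSpace ℝ V] [FiniteDimensional ℝ V] [MeasurableSpace V]
    [BorelSpace V] (L : V →ₗᵢ[ℝ] E n) {S : Submodule ℝ V} (hS : S.map L.toLinearMap = ζ.dir)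
    {a : E n} (ha : a ∈ ζ.space) :
    planeTransform j f ζ = ∫ s : S, f (a + L s) := by
  obtain ⟨Φ, hΦ, h⟩ := ζ.exists_parametrization L hS ha
  rw [planeTransform, ← hΦ.integral_comp Φ.measurableEmbedding]
  simp only [h]

theorem planeTransformExists_iff {j : ℕ} (f : E n → ℂ) (ζ : AffGr n j) {V : Type*}
    [NormedAddCommGroup V] [InnerProductSpace ℝ V] [FiniteDimensional ℝ V] [MeasurableSpace V]
    [BorelSpace V] (L : V →ₗᵢ[ℝ] E n) {S : Submodule ℝ V} (hS : S.map L.toLinearMap = ζ.dir)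
    {a : E n} (ha : a ∈ ζ.space) :
    PlaneTransformExists j f ζ ↔ Integrable fun s : S => f (a + L s) := by
  obtain ⟨Φ, hΦ, h⟩ := ζ.exists_parametrization L hS ha
  rw [PlaneTransformExists, ← hΦ.integrable_comp_emb Φ.measurableEmbedding]
  simp only [Function.comp_def, h]

theorem mem_plane {j : ℕ} (ξ : Gr (E n) j) (a : E n) : a ∈ (plane ξ a).space :=
  AffineSubspace.self_mem_mk' a ξ.space

theorem dir_plane {j : ℕ} (ξ : Gr (E n) j) (a : E n) : (plane ξ a).dir = ξ.space :=
  AffineSubspace.direction_mk' a ξ.space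

/-- The `j`-planes which meet `ζ = γ η₀ + x` at a right angle are the planes
`γ ξ + (x + γ u)`, with `ξ ∈ G_j(η₀ᗮ)` and `u ∈ η₀`. The parametrization by `(ξ, u)` preserves
the measures, and expresses the `j`-plane transform as an integral over `η₀ᗮ`. -/
theorem exists_incidence_parametrization {j k : ℕ} (η₀ : Gr (E n) k) (γ : OrthGroup (E n))
    (x : E n) (hne : Nonempty (Gr η₀.spaceᗮ j)) :
    let ζ := plane (Gr.rotate γ η₀) x
    ∃ Φ : Gr η₀.spaceᗮ j × η₀.space ≃ᵐ Gr ζ.dirᗮ j × ζ.dir,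
      MeasurePreserving Φ ((grMeasure η₀.spaceᗮ j).prod volume) (incidenceMeasure j ζ) ∧
      ∀ (h : E n → ℂ) (q : Gr η₀.spaceᗮ j × η₀.space),
        (planeTransform j h (plane (Φ q).1.incl ((Φ q).2 + ζ.foot)) =
          ∫ z : η₀.spaceᗮ, Param.weight (γ, q, z) • h (x + Param.point (γ, q, z))) ∧
        (Integrable (fun z : η₀.spaceᗮ =>
            Param.weight (γ, q, z) • h (x + Param.point (γ, q, z))) →
          PlaneTransformExists j h (plane (Φ q).1.incl ((Φ q).2 + ζ.foot))) := by
  intro ζ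
  let L : E n ≃ₗᵢ[ℝ] E n := Unitary.linearIsometryEquiv γ
  have hdir : η₀.space.map L.toLinearIsometry.toLinearMap = ζ.dir :=
    (dir_plane (Gr.rotate γ η₀) x).symm
  have hort : η₀.spaceᗮ.map L.toLinearIsometry.toLinearMap = ζ.dirᗮ := by
    rw [← hdir]
    exact Submodule.map_orthogonal_equiv η₀.space L
  let e : η₀.spaceᗮ ≃ₗᵢ[ℝ] ζ.dirᗮ := restrictIsometry L.toLinearIsometry hort
  obtain ⟨Φ, hΦ, hΦx⟩ := ζ.exists_parametrization L.toLinearIsometry hdir (mem_plane _ x)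
  refine ⟨MeasurableEquiv.prodCongr (Gr.mapEquiv j e) Φ,
    (Gr.measurePreserving_mapEquiv e hne).prod hΦ, ?_⟩
  rintro h ⟨ξ, u⟩
  let M : η₀.spaceᗮ →ₗᵢ[ℝ] E n := L.toLinearIsometry.comp η₀.spaceᗮ.subtypeₗᵢ
  have hM : ξ.space.map M.toLinearMap =
      (plane (Gr.map e ξ).incl (Φ u + ζ.foot)).dir := by
    rw [dir_plane]
    change _ = (ξ.space.map (e.toLinearEquiv : η₀.spaceᗮ →ₗ[ℝ] ζ.dirᗮ)).map ζ.dirᗮ.subtype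
    rw [← Submodule.map_comp]
    rfl
  have hpt (z : η₀.spaceᗮ) : x + Param.point (γ, (ξ, u), z) =
      Φ u + ζ.foot + M (ξ.space.starProjection z) := by
    rw [add_comm (Φ u : E n), hΦx, add_assoc]
    exact congrArg (x + ·) (L.map_add _ _)
  simp only [hpt]
  constructor
  · refine (planeTransform_eq h _ M hM (mem_plane _ _)).trans ?_
    exact (integral_gaussWeight ξ.space fun z => h (Φ u + ζ.foot + M z)).symm
  · intro hint
    refine (planeTransformExists_iff h _ M hM (mem_plane _ _)).2 ?_
    exact integrable_of_gaussWeight ξ.space (f := fun z => h (Φ u + ζ.foot + M z)) hint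

end Transforms

/-! ### The composition of the transforms -/

section Composition

variable {n j k : ℕ} {η₀ : Gr (E n) k} {h : E n → ℂ} {x : E n}

/-- The integral over all parameters exists and equals a multiple of the Riesz potential. -/
theorem integrable_param_and_integral_eq (hpos : 0 < k + j) (hlt : k + j < n)
    (hx : RieszPotentialExists ((j : ℝ) + k) h x) :
    Integrable (fun p : Param j η₀.space => p.weight • h (x + p.point))
        (paramMeasure j η₀.space) ∧
      ∫ p : Param j η₀.space, p.weight • h (x + p.point) ∂paramMeasure j η₀.space =
        (sphereArea (k + j) / sphereArea n) •
          ∫ y, (‖x - y‖ ^ ((n : ℝ) - ((j : ℝ) + k)))⁻¹ • h y := by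
  have hlaw := map_point_paramMeasure (n := n) (j := j) (X := η₀.space)
    (by rwa [η₀.finrank_eq]) (by rwa [η₀.finrank_eq])
  rw [η₀.finrank_eq, Nat.cast_add, add_comm (k : ℝ)] at hlaw
  set s : ℝ := (n : ℝ) - ((j : ℝ) + k)
  have hw := Param.measurable_weight (j := j) (X := η₀.space)
  have hp := Param.measurable_point (j := j) (X := η₀.space)
  have hc : 0 ≤ sphereArea (k + j) / sphereArea n :=
    (div_pos (sphereArea_pos hpos) (sphereArea_pos (by omega))).le
  have hcoe (v : E n) : ((‖v‖ ^ s)⁻¹.toNNReal : ℝ) = (‖v‖ ^ s)⁻¹ :=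
    Real.coe_toNNReal _ (by positivity)
  have hwcoe (p : Param j η₀.space) : (p.weight.toNNReal : ℝ) = p.weight :=
    Real.coe_toNNReal _ (gaussWeight_nonneg _ _)
  have hshift (v : E n) : (‖x - (x + v)‖ ^ s)⁻¹ • h (x + v) = (‖v‖ ^ s)⁻¹ • h (x + v) := by
    rw [sub_add_cancel_left, norm_neg]
  have hDm : Measurable fun v : E n => (‖v‖ ^ s)⁻¹.toNNReal := by fun_prop
  have hint1 : Integrable (fun v => h (x + v))
      ((volume : Measure (E n)).withDensity fun v => ((‖v‖ ^ s)⁻¹.toNNReal : ENNReal)) := by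
    rw [integrable_withDensity_iff_integrable_smul hDm]
    simp only [NNReal.smul_def, hcoe, ← hshift]
    exact Integrable.comp_add_left hx x
  have hint2 : Integrable (fun v => h (x + v)) (((paramMeasure j η₀.space).withDensity
      fun p => (p.weight.toNNReal : ENNReal)).map Param.point) := by
    rw [hlaw]
    exact hint1.smul_measure ENNReal.ofReal_ne_top
  constructor
  · have := hint2.comp_measurable hp
    rw [integrable_withDensity_iff_integrable_smul (by fun_prop)] at this
    simpa only [Function.comp_apply, NNReal.smul_def, hwcoe] using this
  · have h1 := integral_map hp.aemeasurable hint2.aestronglyMeasurable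
    rw [integral_withDensity_eq_integral_smul (by fun_prop), hlaw, integral_smul_measure,
      integral_withDensity_eq_integral_smul hDm, ENNReal.toReal_ofReal hc] at h1
    simp only [NNReal.smul_def, hcoe, hwcoe, ← hshift] at h1
    rw [← h1, integral_add_left_eq_self (fun y => (‖x - y‖ ^ s)⁻¹ • h y) x]

/-- The iterated integral which defines `R_k^* R_{j,k} R_j h` is, in parametrized form, the
integral over all parameters, so that Fubini's theorem applies. -/
theorem lamExists_and_lam_eq (hpos : 0 < k + j) (hlt : k + j < n)
    (hx : RieszPotentialExists ((j : ℝ) + k) h x) :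
    LamExists j η₀ h x ∧ Lam j η₀ h x = (sphereArea (k + j) / sphereArea n) •
      ∫ y, (‖x - y‖ ^ ((n : ℝ) - ((j : ℝ) + k)))⁻¹ • h y := by
  obtain ⟨hint, hval⟩ := integrable_param_and_integral_eq (η₀ := η₀) hpos hlt hx
  have hne : Nonempty (Gr η₀.spaceᗮ j) := Gr.nonempty (by
    have := Submodule.finrank_add_finrank_orthogonal η₀.space
    rw [finrank_euclideanSpace_fin, η₀.finrank_eq] at this
    omega)
  have hgood : ∀ᵐ γ ∂haarO (E n),
      (MixedTransformExists j k (planeTransform j h) (plane (Gr.rotate γ η₀) x) ∧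
      ∀ᵐ p ∂(incidenceMeasure j (plane (Gr.rotate γ η₀) x)), PlaneTransformExists j h
        (plane p.1.incl (p.2 + (plane (Gr.rotate γ η₀) x).foot))) ∧
      mixedTransform j k (planeTransform j h) (plane (Gr.rotate γ η₀) x) =
        ∫ q, Param.weight (γ, q) • h (x + Param.point (γ, q))
          ∂((grMeasure η₀.spaceᗮ j).prod volume).prod volume := by
    filter_upwards [hint.prod_right_ae] with γ hγ
    obtain ⟨Φ, hΦ, hPT⟩ := exists_incidence_parametrization (j := j) η₀ γ x hne
    have hmix : MixedTransformExists j k (planeTransform j h) (plane (Gr.rotate γ η₀) x) := by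
      rw [MixedTransformExists, ← hΦ.integrable_comp_emb Φ.measurableEmbedding]
      simp only [Function.comp_def, fun q => (hPT h q).1]
      exact hγ.integral_prod_left
    refine ⟨⟨hmix, ?_⟩, ?_⟩
    · rw [← hΦ.map_eq, Φ.measurableEmbedding.ae_map_iff]
      filter_upwards [hγ.prod_right_ae] with q hq using (hPT h q).2 hq
    · rw [integral_prod _ hγ]
      simp only [← fun q => (hPT h q).1]
      rw [hΦ.integral_comp Φ.measurableEmbedding (fun p => planeTransform j h
        (plane p.1.incl (p.2 + (plane (Gr.rotate γ η₀) x).foot)))]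
      exact (integral_prod _ hmix).symm
  have heq := hgood.mono fun γ hγ => hγ.2
  refine ⟨⟨?_, hgood.mono fun γ hγ => hγ.1⟩, ?_⟩
  · exact (integrable_congr heq).2 hint.integral_prod_left
  · rw [Lam, dualTransform, integral_congr_ae heq, ← hval]
    exact (integral_prod _ hint).symm

/-- The product of the constant of the theorem and of the normalizing constant of the Riesz
potential is a quotient of areas of unit spheres. -/
theorem sphereArea_div_eq (hpos : 0 < j + k) (hlt : j + k < n) :
    2 ^ (j + k) * Real.pi ^ (((j : ℝ) + k) / 2) * Real.Gamma ((n : ℝ) / 2) /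
        Real.Gamma (((n : ℝ) - j - k) / 2) * (rieszConst n ((j : ℝ) + k))⁻¹ =
      sphereArea (j + k) / sphereArea n := by
  have hm : (0 : ℝ) < (j : ℝ) + k := by exact_mod_cast hpos
  have hnm : (j : ℝ) + k < n := by exact_mod_cast hlt
  have hG1 := Real.Gamma_pos_of_pos (s := (n : ℝ) / 2) (by linarith)
  have hG2 := Real.Gamma_pos_of_pos (s := ((j : ℝ) + k) / 2) (by linarith)
  have hG3 := Real.Gamma_pos_of_pos (s := ((n : ℝ) - (j + k)) / 2) (by linarith)
  have hp := Real.rpow_pos_of_pos Real.pi_pos ((n : ℝ) / 2)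
  have h2 : (2 : ℝ) ^ ((j : ℝ) + k) = 2 ^ (j + k) := by
    rw [← Nat.cast_add, Real.rpow_natCast]
  rw [rieszConst, sphereArea, sphereArea, sub_sub, h2, Nat.cast_add]
  field_simp

end Composition

end MixedRadon

end

theorem mainTheorem3 (n j k : ℕ) (hpos : 0 < j + k) (hlt : j + k < n)
    (ξ₀ : MixedRadon.Gr (MixedRadon.E n) j) (η₀ : MixedRadon.Gr (MixedRadon.E n) k)
    (h : MixedRadon.E n → ℂ) (x : MixedRadon.E n)
    (hx : MixedRadon.RieszPotentialExists ((j : ℝ) + k) h x) :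
    MixedRadon.LamExists j η₀ h x ∧ MixedRadon.LamExists k ξ₀ h x ∧
    MixedRadon.Lam j η₀ h x = MixedRadon.Lam k ξ₀ h x ∧
    MixedRadon.Lam k ξ₀ h x =
      (2 ^ (j + k) * Real.pi ^ (((j : ℝ) + k) / 2) * Real.Gamma ((n : ℝ) / 2) /
        Real.Gamma (((n : ℝ) - j - k) / 2)) •
      MixedRadon.rieszPotential ((j : ℝ) + k) h x := by
  obtain ⟨h1, e1⟩ := MixedRadon.lamExists_and_lam_eq (η₀ := η₀) (by omega) (by omega) hx
  obtain ⟨h2, e2⟩ := MixedRadon.lamExists_and_lam_eq (η₀ := ξ₀) hpos hlt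
    (by rwa [add_comm (k : ℝ)])
  rw [add_comm (k : ℝ)] at e2
  rw [add_comm k j] at e1
  refine ⟨h1, h2, e1.trans e2.symm, ?_⟩
  rw [e2, MixedRadon.rieszPotential, smul_smul, MixedRadon.sphereArea_div_eq hpos hlt]
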